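/- Let $\mathcal X$ be a nonempty finite set, let $\mathcal Y$ be a finite abelian group with $M$ elements, let $\triangleleft\ \subseteq \mathcal Y\times\mathcal X$ be an arbitrary relation, and set $T:=\max_{x\in\mathcal X}|\{y\in\mathcal Y : y\triangleleft x\}|$. Let $k\ge 1$ and $q\ge 0$ be integers. A *$k$-parallel $q$-query quantum oracle algorithm* $\mathcal A$ with output in $\mathcal X^{\ell}$ acts on $\mathbb C[\mathcal X]^{\otimes k}\otimes\mathbb C[\mathcal Y]^{\otimes k}\otimes\mathbb C^d$ for some $d\in\mathbb N$. It consists of a unit initial state $\psi_0$, unitaries $U_1,\dots,U_q$ on this space, and a function that assigns an output in $\mathcal X^{\ell}$ to each computational basis label. On the oracle $H:\mathcal X\to\mathcal Y$ its final state is $U_q\,\mathsf O_H^k\cdots U_1\,\mathsf O_H^k\,\psi_0$, where $\mathsf O_H^k:|{\bf x}\rangle|{\bf y}\rangle|w\rangle\mapsto|{\bf x}\rangle|{\bf y}+H({\bf x})\rangle|w\rangle$ with $H({\bf x})=(H(x_1),\dots,H(x_k))$; all registers are then measured in the computational basis, and the output is determined from the measured label. Let $p$ be the probability, over a uniformly random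 $H:\mathcal X\to\mathcal Y$ and the measurement, that such an algorithm with output $(x_0,x_1,\dots,x_{q+1})\in\mathcal X^{q+2}$ satisfies $H(x_i)\triangleleft x_{i+1}$ for all $i\in\{0,\dots,q\}$. Then $$ p\ \le\ B:=\Bigl(qke\sqrt{\tfrac{10qkT}{M}}+e(q+2)\sqrt{\tfrac{10T(q+2)}{M}}+\sqrt{\tfrac{q+2}{M}}\Bigr)^2 , $$ where $e$ is Euler's number. Moreover $B=O(q^3k^3T/M)$ and $p=O(q^3k^3T/M)$, in the following sense: there is an absolute constant $C>0$ such that $B\le C\,q^3k^3T/M$ whenever $q\ge1$ and $T\ge1$, and $p\le C\,q^3k^3T/M$ whenever $q\ge1$. -/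

import Mathlib

noncomputable section

/-- Labels `(x, y, w)` of the computational basis of `ℂ[X]^{⊗k} ⊗ ℂ[Y]^{⊗k} ⊗ ℂ^d`:
`k` query registers, `k` response registers, and a work register of dimension `d`. -/
abbrev QLabel (X Y : Type*) (k d : ℕ) : Type _ :=
  (Fin k → X) × (Fin k → Y) × Fin d

/-- The Hilbert space `ℂ[X]^{⊗k} ⊗ ℂ[Y]^{⊗k} ⊗ ℂ^d` on which an algorithm acts. -/
abbrev QSpace (X Y : Type*) (k d : ℕ) : Type _ :=
  EuclideanSpace ℂ (QLabel X Y k d)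

/-- The permutation `(x, y, w) ↦ (x, y + H(x), w)` of the basis labels, where
`H(x) = (H(x₁), …, H(x_k))`. -/
def queryPerm {X Y : Type*} [AddCommGroup Y] (k d : ℕ) (H : X → Y) :
    QLabel X Y k d ≃ QLabel X Y k d where
  toFun b := (b.1, fun i => b.2.1 i + H (b.1 i), b.2.2)
  invFun b := (b.1, fun i => b.2.1 i - H (b.1 i), b.2.2)
  left_inv b := by simp
  right_inv b := by simp

/-- One `k`-parallel query to `H`: the unitary `|x⟩|y⟩|w⟩ ↦ |x⟩|y + H(x)⟩|w⟩`. -/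
def parallelQuery {X Y : Type*} [Fintype X] [Fintype Y] [AddCommGroup Y] (k d : ℕ) (H : X → Y) :
    QSpace X Y k d ≃ₗᵢ[ℂ] QSpace X Y k d :=
  LinearIsometryEquiv.piLpCongrLeft 2 ℂ ℂ (queryPerm k d H)

theorem parallelQuery_single {X Y : Type*} [Fintype X] [Fintype Y] [DecidableEq X] [DecidableEq Y]
    [AddCommGroup Y] (k d : ℕ) (H : X → Y) (x : Fin k → X) (y : Fin k → Y) (w : Fin d) :
    parallelQuery k d H (EuclideanSpace.single (x, y, w) 1) =
      EuclideanSpace.single (x, (fun i => y i + H (x i)), w) 1 := by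
  simp [parallelQuery, queryPerm, EuclideanSpace.single]

/-- A `k`-parallel `q`-query quantum oracle algorithm with outputs in `X^ℓ`. It starts in an
arbitrary pure state; the `s`-th query is followed by a unitary that acts on all registers of the
algorithm; at the end all registers are measured in the computational basis, and the output is read
off the measured label. Nothing here depends on the oracle function. -/
structure ParallelQueryAlgorithm (X Y : Type*) [Fintype X] [Fintype Y] (k q ℓ : ℕ) where
  /-- dimension of the work register -/
  dim : ℕ
  /-- initial state -/
  init : QSpace X Y k dim
  norm_init : ‖init‖ = 1
  /-- unitaries applied after the queries -/
  U : Fin q → (QSpace X Y k dim ≃ₗᵢ[ℂ] QSpace X Y k dim)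
  /-- output determined by the measured label -/
  output : QLabel X Y k dim → Fin ℓ → X

namespace ParallelQueryAlgorithm

variable {X Y : Type*} [Fintype X] [Fintype Y] [AddCommGroup Y] {k q ℓ : ℕ}

/-- The state after `s ≤ q` rounds (query, then unitary) of interaction with the oracle `H`. -/
def state (A : ParallelQueryAlgorithm X Y k q ℓ) (H : X → Y) :
    (s : ℕ) → s ≤ q → QSpace X Y k A.dim
  | 0, _ => A.init
  | s + 1, h =>
      A.U ⟨s, h⟩ (parallelQuery k A.dim H (state A H s (Nat.le_of_succ_le h)))

/-- The state after all `q` rounds. -/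
def finalState (A : ParallelQueryAlgorithm X Y k q ℓ) (H : X → Y) : QSpace X Y k A.dim :=
  A.state H q le_rfl

open Classical in
/-- The probability, by the Born rule, that the output of `A` on the fixed oracle `H`
satisfies `P`. -/
def outputProb (A : ParallelQueryAlgorithm X Y k q ℓ) (H : X → Y) (P : (Fin ℓ → X) → Prop) : ℝ :=
  ∑ b : QLabel X Y k A.dim, if P (A.output b) then ‖A.finalState H b‖ ^ 2 else 0

/-- The probability that the output `x` of `A` satisfies `P H x`, where the oracle `H` is a
uniformly random function `X → Y`. -/
def successProb [DecidableEq X] (A : ParallelQueryAlgorithm X Y k q ℓ)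
    (P : (X → Y) → (Fin ℓ → X) → Prop) : ℝ :=
  (∑ H : X → Y, A.outputProb H (P H)) / (Fintype.card (X → Y) : ℝ)

end ParallelQueryAlgorithm

/-- `x₀, …, x_{q+1}` is a `(q+1)`-chain for `H`: `H(x_i) ◁ x_{i+1}` for `i = 0, …, q`. -/
def IsChainFor {X Y : Type*} (rel : Y → X → Prop) {q : ℕ} (H : X → Y) (x : Fin (q + 2) → X) :
    Prop :=
  ∀ i : Fin (q + 1), rel (H (x i.castSucc)) (x i.succ)

/-- `T = max_x |{y : y ◁ x}|` (for nonempty `X`). -/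
def maxRelCard {X Y : Type*} [Fintype X] (rel : Y → X → Prop) : ℕ :=
  Finset.univ.sup fun x : X => Set.ncard {y : Y | rel y x}

/-- The bound
`(q k e √(10 q k T / M) + e (q+2) √(10 T (q+2) / M) + √((q+2) / M))²`. -/
def chainBound (q k T M : ℕ) : ℝ :=
  ((q : ℝ) * k * Real.exp 1 * Real.sqrt (10 * q * k * T / M)
    + Real.exp 1 * ((q : ℝ) + 2) * Real.sqrt (10 * T * ((q : ℝ) + 2) / M)
    + Real.sqrt (((q : ℝ) + 2) / M)) ^ 2

end

/-!
The proof is a version of the compressed oracle technique. The random oracle is purified: its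
function table becomes a quantum register that holds a uniform superposition of all functions. It
is enlarged to the space of databases, partial functions `X → Option Y`, and each register is
reflected by `swapMatrix`, which exchanges the undefined value `none` with the uniform
superposition of `Y`. In this picture the initial state is the empty database, and a query at `x`
acts on the register `x` only (`onRegister_queryKernel`). So the database is defined on at
most `s k` points after `s` rounds. `decompress_compressedState` identifies the reflected run with the purified run.

The core is a transition bound for a composition of `n` operators on single registers
(`l2_indicator_onRegisters_le`). The kernel of each operator has small entries in the rows of
defined values, off the diagonal. Hence the part that writes into its register a new value from a
given set of `m` values has norm at most `ε = √(20 m / |Y|)`. Removing these parts from all `n`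
operators costs at most `(1 + ε) ^ n - 1`, and what is left cannot reach a database that is
reachable only by writing such a value.

The bound is applied twice. A round in which the longest chain grows from at most `s` to `s + 2`
links must write a value that is related to a point queried or already defined, hence one of at
most `q k T` values (`l2_indicator_chainSet_compressedQuery_le`). So up to a small amplitude the
database has no chain of `q + 1` links after `q` rounds. If it has none, then decompressing the
registers of the output makes all `q + 1` links of the output true only by a value related to one
of the output points, hence one of at most `(q + 1) T` values
(`l2_indicator_decompress_chain_le`). The sum of these amplitudes is bounded by the first two
summands of the claim, because either `(1 + ε) ^ n - 1` is at most a constant times `n ε`, or the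
claimed bound is at least `1`.
-/

noncomputable section

open Finset Function

/-! ### Square-summable families -/

/-- The `ℓ²` norm of a finite family of vectors. -/
def l2 {ι R : Type*} [Fintype ι] [NormedAddCommGroup R] (φ : ι → R) : ℝ :=
  ‖WithLp.toLp 2 φ‖

section L2

variable {ι R : Type*} [Fintype ι] [NormedAddCommGroup R]

theorem l2_nonneg (φ : ι → R) : 0 ≤ l2 φ := norm_nonneg _

theorem l2_sq (φ : ι → R) : l2 φ ^ 2 = ∑ i, ‖φ i‖ ^ 2 :=
  PiLp.norm_sq_eq_of_L2 _ _

theorem l2_add_le (φ ψ : ι → R) : l2 (φ + ψ) ≤ l2 φ + l2 ψ :=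
  norm_add_le (WithLp.toLp 2 φ) (WithLp.toLp 2 ψ)

theorem l2_sub_rev (φ ψ : ι → R) : l2 (φ - ψ) = l2 (ψ - φ) :=
  norm_sub_rev (WithLp.toLp 2 φ) (WithLp.toLp 2 ψ)

theorem l2_le_mul {κ S : Type*} [Fintype κ] [NormedAddCommGroup S] {φ : ι → R} {ψ : κ → S}
    {c : ℝ} (hc : 0 ≤ c) (h : ∑ i, ‖φ i‖ ^ 2 ≤ c ^ 2 * ∑ i, ‖ψ i‖ ^ 2) : l2 φ ≤ c * l2 ψ := by
  refine le_of_sq_le_sq ?_ (mul_nonneg hc (l2_nonneg _))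
  rwa [mul_pow, l2_sq, l2_sq]

theorem l2_le {κ S : Type*} [Fintype κ] [NormedAddCommGroup S] {φ : ι → R} {ψ : κ → S}
    (h : ∑ i, ‖φ i‖ ^ 2 ≤ ∑ i, ‖ψ i‖ ^ 2) : l2 φ ≤ l2 ψ := by
  simpa using l2_le_mul (φ := φ) (ψ := ψ) zero_le_one (by simpa using h)

theorem l2_indicator_le (s : Set ι) (φ : ι → R) : l2 (s.indicator φ) ≤ l2 φ := by
  refine l2_le (sum_le_sum fun i _ => ?_)
  gcongr
  exact norm_indicator_le_norm_self φ i

end L2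

/-! ### Databases and operators on one register -/

/-- Databases: partial functions from `X` to `Y`, with `none` for an undefined value. -/
abbrev Database (X Y : Type*) : Type _ := X → Option Y

/-- The matrix of the reflection of `ℂ[Y ∪ {none}]` that exchanges `none` with the uniform
superposition of `Y` and fixes the orthogonal complement of these two vectors. -/
def swapMatrix {Y : Type*} [Fintype Y] [DecidableEq Y] : Option Y → Option Y → ℂ
  | none, none => 0
  | none, some _ => 1 / (√(Fintype.card Y) : ℝ)
  | some _, none => 1 / (√(Fintype.card Y) : ℝ)
  | some y, some z => (if y = z then 1 else 0) - 1 / (Fintype.card Y : ℝ)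

section SwapMatrix

variable {Y : Type*} [Fintype Y] [DecidableEq Y]

theorem swapMatrix_symm (u v : Option Y) : swapMatrix u v = swapMatrix v u := by
  rcases u with _ | u <;> rcases v with _ | v <;> simp [swapMatrix, eq_comm]

theorem conj_swapMatrix (u v : Option Y) : (starRingEnd ℂ) (swapMatrix u v) = swapMatrix u v := by
  rcases u with _ | u <;> rcases v with _ | v <;> simp [swapMatrix, apply_ite]

theorem sum_swapMatrix_mul [Nonempty Y] (u w : Option Y) :
    ∑ v, swapMatrix u v * swapMatrix v w = if u = w then 1 else 0 := by
  have hM : (Fintype.card Y : ℂ) ≠ 0 := by simp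
  have hs : ((√(Fintype.card Y) : ℝ) : ℂ)⁻¹ * ((√(Fintype.card Y) : ℝ) : ℂ)⁻¹
      = (Fintype.card Y : ℂ)⁻¹ := by
    rw [← mul_inv, ← Complex.ofReal_mul, Real.mul_self_sqrt (Nat.cast_nonneg _),
      Complex.ofReal_natCast]
  rcases u with _ | u <;> rcases w with _ | w <;>
    simp [Fintype.sum_option, swapMatrix, mul_sub, sub_mul, sum_sub_distrib, hs, hM]
  rw [mul_left_comm, mul_inv_cancel₀ hM, mul_one, sub_self]

theorem sum_norm_sq_swapMatrix [Nonempty Y] {R : Type*} [NormedAddCommGroup R]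
    [InnerProductSpace ℂ R] (a : Option Y → R) :
    ∑ u, ‖∑ v, swapMatrix u v • a v‖ ^ 2 = ∑ v, ‖a v‖ ^ 2 := by
  have h : ∑ u, inner ℂ (∑ v, swapMatrix u v • a v) (∑ v, swapMatrix u v • a v)
      = ∑ v, inner ℂ (a v) (a v) := by
    simp only [sum_inner, inner_sum, inner_smul_left, inner_smul_right, conj_swapMatrix]
    simp only [mul_sum]
    rw [sum_comm]
    refine sum_congr rfl fun v _ => ?_
    rw [sum_comm]
    have (w : Option Y) : ∑ u, swapMatrix u v * (swapMatrix u w * inner ℂ (a w) (a v))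
        = if v = w then inner ℂ (a w) (a v) else 0 := by
      simp_rw [← mul_assoc, ← sum_mul, swapMatrix_symm _ v]
      rw [sum_swapMatrix_mul, ite_mul, one_mul, zero_mul]
    simp [this]
  simp only [inner_self_eq_norm_sq_to_K] at h
  exact_mod_cast h

end SwapMatrix

section Register

variable {X Y R : Type*} [DecidableEq X] [Fintype Y]
variable [AddCommGroup R] [Module ℂ R]

/-- The operator on families of vectors indexed by databases that acts on the register `x`
alone, through the operator-valued kernel `K`. -/
def onRegister (x : X) (K : Option Y → Option Y → R →ₗ[ℂ] R) :
    Module.End ℂ (Database X Y → R) where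
  toFun φ D := ∑ r, K (D x) r (φ (update D x r))
  map_add' φ ψ := by ext D; simp [sum_add_distrib]
  map_smul' c φ := by ext D; simp [smul_sum]

theorem onRegister_apply (x : X) (K : Option Y → Option Y → R →ₗ[ℂ] R) (φ : Database X Y → R)
    (D : Database X Y) : onRegister x K φ D = ∑ r, K (D x) r (φ (update D x r)) := rfl

theorem onRegister_mul (x : X) (K K' : Option Y → Option Y → R →ₗ[ℂ] R) :
    onRegister x K * onRegister x K' = onRegister x fun u r => ∑ v, K u v ∘ₗ K' v r := by
  ext φ D
  simp only [Module.End.mul_apply, onRegister_apply, update_self, update_idem, map_sum,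
    LinearMap.sum_apply, LinearMap.comp_apply]
  exact sum_comm

variable [DecidableEq Y]

/-- The reflection of the register `x` that exchanges `none` with the uniform superposition of `Y`;
it serves both for compression and for decompression. -/
def swapAt (x : X) : Module.End ℂ (Database X Y → R) :=
  onRegister x fun u v => swapMatrix u v • LinearMap.id

theorem swapAt_apply (x : X) (φ : Database X Y → R) (D : Database X Y) :
    swapAt x φ D = ∑ v, swapMatrix (D x) v • φ (update D x v) := rfl

theorem swapAt_mul_self [Nonempty Y] (x : X) :
    (swapAt x * swapAt x : Module.End ℂ (Database X Y → R)) = 1 := by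
  rw [swapAt, onRegister_mul]
  ext φ D
  have h (u r : Option Y) : ∑ v, swapMatrix v r * swapMatrix u v = if u = r then 1 else 0 := by
    simp_rw [mul_comm (swapMatrix _ r)]
    exact sum_swapMatrix_mul u r
  simp only [onRegister_apply, LinearMap.comp_smul, LinearMap.comp_id, smul_smul, ← sum_smul, h,
    ite_smul, one_smul, zero_smul]
  rw [Fintype.sum_eq_single (D x) fun r hr => by rw [if_neg hr.symm, LinearMap.zero_apply],
    if_pos rfl, LinearMap.id_apply, update_eq_self, Module.End.one_apply]

theorem commute_onRegister_swapAt {x z : X} (h : x ≠ z) (K : Option Y → Option Y → R →ₗ[ℂ] R) :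
    Commute (onRegister x K) (swapAt z) := by
  ext φ D
  simp only [Module.End.mul_apply, onRegister_apply, swapAt_apply, map_sum, map_smul, smul_sum,
    update_of_ne h, update_of_ne h.symm]
  rw [sum_comm]
  refine sum_congr rfl fun u _ => sum_congr rfl fun v _ => ?_
  rw [update_comm h]

theorem commute_swapAt (x z : X) :
    Commute (swapAt x : Module.End ℂ (Database X Y → R)) (swapAt z) := by
  rcases eq_or_ne x z with rfl | h
  · exact Commute.refl _
  · exact commute_onRegister_swapAt h _

end Register

/-- A sum over databases may be compared along the fibres of forgetting the register `x`. -/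
theorem sum_le_sum_of_fiber {X β : Type*} [Fintype X] [DecidableEq X] [Fintype β] (x : X)
    (f g : (X → β) → ℝ)
    (h : ∀ D, ∑ u, f (update D x u) ≤ ∑ u, g (update D x u)) : ∑ D, f D ≤ ∑ D, g D := by
  classical
  have key : ∀ f : (X → β) → ℝ, ∑ D, f D
      = ∑ D : {j // j ≠ x} → β, ∑ u, f ((Equiv.funSplitAt x β).symm (u, D)) := by
    intro f
    rw [← (Equiv.funSplitAt x β).symm.sum_comp, Fintype.sum_prod_type_right]
  rw [key f, key g]
  refine sum_le_sum fun D _ => ?_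
  have hup : ∀ u v, (Equiv.funSplitAt x β).symm (u, D)
      = update ((Equiv.funSplitAt x β).symm (v, D)) x u := by
    intro u v
    funext j
    rcases eq_or_ne j x with rfl | hj
    · rw [update_self, Equiv.funSplitAt_symm_apply, dif_pos rfl]
    · rw [update_of_ne hj, Equiv.funSplitAt_symm_apply, Equiv.funSplitAt_symm_apply,
        dif_neg hj, dif_neg hj]
  rcases isEmpty_or_nonempty β with hβ | ⟨⟨v⟩⟩
  · rw [sum_of_isEmpty, sum_of_isEmpty]
  · rw [sum_congr rfl fun u _ => congrArg f (hup u v),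
      sum_congr rfl fun u _ => congrArg g (hup u v)]
    exact h _

/-! ### Transitions caused by a sequence of one-register operators -/

section Tame

variable {Y R : Type*} [Fintype Y] [NormedAddCommGroup R] [Module ℂ R]

/-- An operator-valued kernel on `Option Y` that defines a contraction and whose entries in the row
of a defined value are small: of order `|Y|^(-1/2)` in the column `none`, and of order `|Y|⁻¹` in
the columns of the other defined values. -/
structure IsTame (K : Option Y → Option Y → R →ₗ[ℂ] R) : Prop where
  contract : ∀ a : Option Y → R, ∑ u, ‖∑ r, K u r (a r)‖ ^ 2 ≤ ∑ r, ‖a r‖ ^ 2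
  none_le : ∀ y a, ‖K (some y) none a‖ ≤ 2 / √(Fintype.card Y) * ‖a‖
  some_le : ∀ y z, z ≠ y → ∀ a, ‖K (some y) (some z) a‖ ≤ 4 / Fintype.card Y * ‖a‖

/-- The off-diagonal part of a row of a tame kernel has norm at most `√(20 / |Y|)`. -/
theorem IsTame.sum_offDiag_sq_le [Nonempty Y] [DecidableEq Y]
    {K : Option Y → Option Y → R →ₗ[ℂ] R} (hK : IsTame K) (y : Y) (a : Option Y → R) :
    ‖∑ r, if r = some y then 0 else K (some y) r (a r)‖ ^ 2
      ≤ 20 / Fintype.card Y * ∑ r, ‖a r‖ ^ 2 := by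
  have hM : (0 : ℝ) < Fintype.card Y := by exact_mod_cast Fintype.card_pos
  set M : ℝ := (Fintype.card Y : ℝ)
  set s : ℝ := ∑ z : Y, ‖a (some z)‖ with hs
  have hs2 : s ^ 2 ≤ M * ∑ z : Y, ‖a (some z)‖ ^ 2 := by
    simpa using sq_sum_le_card_mul_sum_sq (s := univ) (f := fun z : Y => ‖a (some z)‖)
  have h1 : ‖∑ r, if r = some y then 0 else K (some y) r (a r)‖
      ≤ 2 / √M * ‖a none‖ + 4 / M * s := by
    rw [Fintype.sum_option, if_neg (by simp), hs, mul_sum]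
    refine (norm_add_le _ _).trans (add_le_add (hK.none_le y _) ?_)
    refine (norm_sum_le _ _).trans (sum_le_sum fun z _ => ?_)
    split_ifs with h
    · rw [norm_zero]; positivity
    · exact hK.some_le y z (fun h' => h (by rw [h'])) _
  have hsq : √M ^ 2 = M := Real.sq_sqrt hM.le
  have hM' : 0 < √M := Real.sqrt_pos.2 hM
  -- Cauchy-Schwarz: `(2 a + 4 b)² ≤ (2² + 4²) (a² + b²)`
  have h2 : (2 / √M * ‖a none‖ + 4 / M * s) ^ 2
      ≤ 20 * (‖a none‖ ^ 2 / M + s ^ 2 / M ^ 2) := by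
    have e1 : ‖a none‖ ^ 2 / M = (‖a none‖ / √M) ^ 2 := by rw [div_pow, hsq]
    rw [e1, ← div_pow]
    have e2 : 2 / √M * ‖a none‖ + 4 / M * s = 2 * (‖a none‖ / √M) + 4 * (s / M) := by ring
    rw [e2]
    nlinarith [sq_nonneg (4 * (‖a none‖ / √M) - 2 * (s / M))]
  calc _ ≤ (2 / √M * ‖a none‖ + 4 / M * s) ^ 2 := by gcongr
    _ ≤ _ := h2
    _ ≤ 20 * (‖a none‖ ^ 2 / M + (M * ∑ z : Y, ‖a (some z)‖ ^ 2) / M ^ 2) := by gcongr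
    _ = _ := by rw [Fintype.sum_option]; field_simp

end Tame

section Transition

variable {X Y R : Type*} [DecidableEq X] [Fintype Y] [NormedAddCommGroup R] [Module ℂ R]

theorem IsTame.l2_onRegister_le [Fintype X] {K : Option Y → Option Y → R →ₗ[ℂ] R}
    (hK : IsTame K) (x : X) (φ : Database X Y → R) : l2 (onRegister x K φ) ≤ l2 φ := by
  refine l2_le (sum_le_sum_of_fiber x _ _ fun D => ?_)
  simpa [onRegister_apply] using hK.contract fun r => φ (update D x r)

/-- The operator `onRegister x K` without the transitions that put a value from `L D` into the
register `x` in place of another one. -/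
def avoiding [DecidableEq Y] (L : Database X Y → Finset Y) (x : X)
    (K : Option Y → Option Y → R →ₗ[ℂ] R) (φ : Database X Y → R) (D : Database X Y) : R :=
  ∑ r, if (∃ y ∈ L D, D x = some y) ∧ r ≠ D x then 0 else K (D x) r (φ (update D x r))

theorem IsTame.l2_sub_avoiding_le [Fintype X] [DecidableEq Y] [Nonempty Y]
    {K : Option Y → Option Y → R →ₗ[ℂ] R}
    (hK : IsTame K) {L : Database X Y → Finset Y} {m : ℕ} (hm : ∀ D, #(L D) ≤ m) (x : X)
    (hL : ∀ D r, L (update D x r) = L D) (φ : Database X Y → R) :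
    l2 (onRegister x K φ - avoiding L x K φ) ≤ √(20 * (m / Fintype.card Y)) * l2 φ := by
  refine l2_le_mul (Real.sqrt_nonneg _) ?_
  rw [Real.sq_sqrt (by positivity), mul_sum]
  refine sum_le_sum_of_fiber x _ _ fun D => ?_
  set a : Option Y → R := fun r => φ (update D x r) with ha
  have h (u : Option Y) : ‖(onRegister x K φ - avoiding L x K φ) (update D x u)‖ ^ 2
      ≤ if ∃ y ∈ L D, u = some y then 20 / Fintype.card Y * ∑ r, ‖a r‖ ^ 2 else 0 := by
    simp only [Pi.sub_apply, onRegister_apply, avoiding, ← sum_sub_distrib, update_self,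
      update_idem, hL]
    split_ifs with hu
    · obtain ⟨y, hy, rfl⟩ := hu
      convert hK.sum_offDiag_sq_le y a using 5 with r
      simp only [true_and, hy, Option.some.injEq, exists_eq_right', ne_eq]
      split_ifs <;> simp [ha]
    · simp [hu]
  calc _ ≤ ∑ u, if ∃ y ∈ L D, u = some y then 20 / Fintype.card Y * ∑ r, ‖a r‖ ^ 2 else 0 :=
        sum_le_sum fun u _ => h u
    _ = #(L D) * (20 / Fintype.card Y * ∑ r, ‖a r‖ ^ 2) := by
        rw [Fintype.sum_option, if_neg (by simp), zero_add]
        simp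
    _ ≤ m * (20 / Fintype.card Y * ∑ r, ‖a r‖ ^ 2) := by
        gcongr
        exact_mod_cast hm D
    _ = _ := by rw [← mul_sum]; ring

/-- The composition of one-register operators; the last operator of the list acts first. -/
def onRegisters (l : List (X × (Option Y → Option Y → R →ₗ[ℂ] R))) :
    Module.End ℂ (Database X Y → R) :=
  (l.map fun p => onRegister p.1 p.2).prod

theorem onRegisters_cons (p : X × (Option Y → Option Y → R →ₗ[ℂ] R))
    (l : List (X × (Option Y → Option Y → R →ₗ[ℂ] R))) (φ : Database X Y → R) :
    onRegisters (p :: l) φ = onRegister p.1 p.2 (onRegisters l φ) := by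
  simp [onRegisters]

/-- The composition of one-register operators in which each operator is replaced by its
`avoiding` part. -/
def avoidings [DecidableEq Y] (L : Database X Y → Finset Y)
    (l : List (X × (Option Y → Option Y → R →ₗ[ℂ] R))) (φ : Database X Y → R) :
    Database X Y → R :=
  l.foldr (fun p ψ => avoiding L p.1 p.2 ψ) φ

theorem l2_onRegisters_le [Fintype X] {l : List (X × (Option Y → Option Y → R →ₗ[ℂ] R))}
    (hl : ∀ p ∈ l, IsTame p.2) (φ : Database X Y → R) : l2 (onRegisters l φ) ≤ l2 φ := by
  induction l with
  | nil => simp [onRegisters]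
  | cons p l ih =>
    rw [onRegisters_cons]
    exact ((hl p (by simp)).l2_onRegister_le _ _).trans (ih fun p hp => hl p (by simp [hp]))

/-- Since the operators are contractions, replacing them one after the other by their `avoiding`
parts costs at most a geometric sum. -/
theorem l2_onRegisters_sub_avoidings_le [Fintype X] [DecidableEq Y] [Nonempty Y]
    {l : List (X × (Option Y → Option Y → R →ₗ[ℂ] R))} (hl : ∀ p ∈ l, IsTame p.2)
    {L : Database X Y → Finset Y} {m : ℕ} (hm : ∀ D, #(L D) ≤ m)
    (hL : ∀ p ∈ l, ∀ D r, L (update D p.1 r) = L D) (φ : Database X Y → R) :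
    l2 (onRegisters l φ - avoidings L l φ)
      ≤ ((1 + √(20 * (m / Fintype.card Y))) ^ l.length - 1) * l2 φ := by
  induction l with
  | nil => simp [onRegisters, avoidings, l2]
  | cons p l ih =>
    set ε := √(20 * (m / Fintype.card Y)) with hε
    have hε0 : 0 ≤ ε := Real.sqrt_nonneg _
    have hl' : ∀ p ∈ l, IsTame p.2 := fun p hp => hl p (by simp [hp])
    have h1 := ih hl' fun p hp => hL p (by simp [hp])
    set T := onRegisters l φ
    set C := avoidings L l φ with hC
    have h2 : l2 C ≤ (1 + ε) ^ l.length * l2 φ := by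
      have := l2_add_le T (C - T)
      rw [add_sub_cancel, l2_sub_rev] at this
      have := l2_onRegisters_le hl' φ
      linarith
    have hp := hl p (by simp)
    have h3 := hp.l2_sub_avoiding_le hm p.1 (hL p (by simp)) C
    have h4 := hp.l2_onRegister_le p.1 (T - C)
    have h5 : onRegisters (p :: l) φ - avoidings L (p :: l) φ
        = onRegister p.1 p.2 (T - C) + (onRegister p.1 p.2 C - avoiding L p.1 p.2 C) := by
      rw [onRegisters_cons, map_sub, sub_add_sub_cancel]
      rfl
    rw [h5]
    refine (l2_add_le _ _).trans ?_
    have h6 : ε * l2 C ≤ ε * ((1 + ε) ^ l.length * l2 φ) := by gcongr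
    rw [List.length_cons, pow_succ]
    linarith

/-- The `avoiding` parts connect `D` only to databases `D'` that differ from `D` in the
registers of the list, and there only where the value in `D` is not in `L D`. -/
theorem exists_of_avoidings_ne_zero [DecidableEq Y]
    {l : List (X × (Option Y → Option Y → R →ₗ[ℂ] R))}
    {L : Database X Y → Finset Y} (hL : ∀ p ∈ l, ∀ D r, L (update D p.1 r) = L D)
    {φ : Database X Y → R} {D : Database X Y} (h : avoidings L l φ D ≠ 0) :
    ∃ D', φ D' ≠ 0 ∧ ∀ z, D' z = D z ∨ (z ∈ l.map Prod.fst ∧ ∀ y ∈ L D, D z ≠ some y) := by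
  induction l generalizing D with
  | nil => exact ⟨D, h, fun z => Or.inl rfl⟩
  | cons p l ih =>
    obtain ⟨r, -, hr⟩ := exists_ne_zero_of_sum_ne_zero
      (show ∑ r, (if (∃ y ∈ L D, D p.1 = some y) ∧ r ≠ D p.1 then 0 else
        p.2 (D p.1) r (avoidings L l φ (update D p.1 r))) ≠ 0 from h)
    split_ifs at hr with hcond
    · exact absurd rfl hr
    obtain ⟨D', hD', hz⟩ := ih (fun p hp => hL p (by simp [hp])) fun h0 => hr (by rw [h0, map_zero])
    refine ⟨D', hD', fun z => ?_⟩
    rw [hL p (by simp)] at hz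
    by_cases hzp : z = p.1
    · subst hzp
      by_cases hy : ∃ y ∈ L D, D p.1 = some y
      · have hrD : r = D p.1 := by
          by_contra hne
          exact hcond ⟨hy, hne⟩
        have := hz p.1
        rw [update_self, hrD] at this
        exact this.imp_right fun h => ⟨by simp, h.2⟩
      · push Not at hy
        exact Or.inr ⟨by simp, hy⟩
    · have := hz z
      rw [update_of_ne hzp] at this
      exact this.imp_right fun h => ⟨by simp [h.1], h.2⟩

/-- If a database in `Q` arises from a database in `P` only by writing a value of `L` into one of
the registers, then a composition of `n` tame operators moves only a small part of a family
supported in `P` to `Q`. -/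
theorem l2_indicator_onRegisters_le [Fintype X] [DecidableEq Y] [Nonempty Y]
    {l : List (X × (Option Y → Option Y → R →ₗ[ℂ] R))} (hl : ∀ p ∈ l, IsTame p.2)
    {L : Database X Y → Finset Y} {m : ℕ} (hm : ∀ D, #(L D) ≤ m)
    (hL : ∀ p ∈ l, ∀ D r, L (update D p.1 r) = L D) {P Q : Set (Database X Y)}
    {φ : Database X Y → R} (hφ : ∀ D, φ D ≠ 0 → D ∈ P)
    (hPQ : ∀ D ∈ Q, ∀ D' ∈ P, (∀ z, D' z ≠ D z → z ∈ l.map Prod.fst) →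
      ∃ z, D' z ≠ D z ∧ ∃ y ∈ L D, D z = some y) :
    l2 (Q.indicator (onRegisters l φ))
      ≤ ((1 + √(20 * (m / Fintype.card Y))) ^ l.length - 1) * l2 φ := by
  have h : Q.indicator (onRegisters l φ)
      = Q.indicator (onRegisters l φ - avoidings L l φ) := by
    ext D
    by_cases hD : D ∈ Q
    · rw [Set.indicator_of_mem hD, Set.indicator_of_mem hD, Pi.sub_apply, eq_comm, sub_eq_self]
      by_contra h0
      obtain ⟨D', hD', hz⟩ := exists_of_avoidings_ne_zero hL h0
      obtain ⟨z, hzne, y, hy, hzy⟩ := hPQ D hD D' (hφ D' hD') fun z hz' =>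
        ((hz z).resolve_left hz').1
      exact ((hz z).resolve_left hzne).2 y hy hzy
    · rw [Set.indicator_of_notMem hD, Set.indicator_of_notMem hD]
  rw [h]
  exact (l2_indicator_le _ _).trans (l2_onRegisters_sub_avoidings_le hl hm hL φ)

/-- A composition of one-register operators changes the registers of the list only. -/
theorem exists_of_onRegisters_ne_zero [DecidableEq Y]
    {l : List (X × (Option Y → Option Y → R →ₗ[ℂ] R))}
    {φ : Database X Y → R} {D : Database X Y} (h : onRegisters l φ D ≠ 0) :
    ∃ D', φ D' ≠ 0 ∧ ∀ z, D' z ≠ D z → z ∈ l.map Prod.fst := by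
  -- With nothing to avoid, `avoidings` is `onRegisters`.
  have h' : avoidings (fun _ => ∅) l φ = onRegisters l φ := by
    clear h
    induction l with
    | nil => rfl
    | cons p l ih =>
      ext D
      rw [onRegisters_cons, ← ih, onRegister_apply]
      simp [avoidings, avoiding]
  rw [← h'] at h
  obtain ⟨D', hD', hz⟩ := exists_of_avoidings_ne_zero (by simp) h
  exact ⟨D', hD', fun z hne => ((hz z).resolve_left hne).1⟩

end Transition

/-! ### Queries to the compressed oracle -/

section Entries

variable {Y : Type*} [Fintype Y] [DecidableEq Y]

theorem norm_swapMatrix_some_none (y : Y) :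
    ‖swapMatrix (some y) none‖ = 1 / √(Fintype.card Y) := by
  simp [swapMatrix, abs_of_nonneg]

theorem norm_swapMatrix_none_some (y : Y) :
    ‖swapMatrix none (some y)‖ = 1 / √(Fintype.card Y) := by
  simp [swapMatrix, abs_of_nonneg]

theorem norm_swapMatrix_some_some_le (y z : Y) :
    ‖swapMatrix (some y) (some z)‖ ≤ (if y = z then 1 else 0) + 1 / Fintype.card Y := by
  refine (norm_sub_le _ _).trans (add_le_add ?_ ?_)
  · split_ifs <;> simp
  · simp

theorem norm_swapMatrix_some_some_of_ne {y z : Y} (h : y ≠ z) :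
    ‖swapMatrix (some y) (some z)‖ = 1 / Fintype.card Y := by
  simp [swapMatrix, h]

theorem sum_norm_swapMatrix_mul_none_le [Nonempty Y] (y : Y) :
    ∑ v, ‖swapMatrix (some y) v * swapMatrix v none‖ ≤ 2 / √(Fintype.card Y) := by
  have hM : (0 : ℝ) < Fintype.card Y := by exact_mod_cast Fintype.card_pos
  have h : ∑ z, ‖swapMatrix (some y) (some z)‖ ≤ 2 := by
    refine (sum_le_sum fun z _ => norm_swapMatrix_some_some_le y z).trans_eq ?_
    rw [sum_add_distrib]
    simp [hM.ne']
    norm_num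
  rw [Fintype.sum_option]
  simp only [norm_mul, norm_swapMatrix_some_none, ← sum_mul]
  simp only [swapMatrix, norm_zero, mul_zero, zero_add]
  rw [mul_one_div]
  gcongr
  exact h

theorem sum_norm_swapMatrix_mul_some_le [Nonempty Y] {y z : Y} (h : z ≠ y) :
    ∑ v, ‖swapMatrix (some y) v * swapMatrix v (some z)‖ ≤ 4 / Fintype.card Y := by
  have hM : (0 : ℝ) < Fintype.card Y := by exact_mod_cast Fintype.card_pos
  rw [Fintype.sum_option]
  simp only [norm_mul, norm_swapMatrix_some_none, norm_swapMatrix_none_some]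
  have h1 : ∑ v : Y, ‖swapMatrix (some y) (some v)‖ * ‖swapMatrix (some v) (some z)‖
      ≤ ∑ v : Y, ((if y = v then 1 / (Fintype.card Y : ℝ) else 0)
        + (if v = z then 1 / (Fintype.card Y : ℝ) else 0) + 1 / (Fintype.card Y : ℝ) ^ 2) := by
    refine sum_le_sum fun v _ => ?_
    refine (mul_le_mul (norm_swapMatrix_some_some_le y v) (norm_swapMatrix_some_some_le v z)
      (norm_nonneg _) (by positivity)).trans ?_
    have : ¬ (y = v ∧ v = z) := fun h' => h (h'.1.trans h'.2).symm
    split_ifs <;> first | (exfalso; tauto) | (ring_nf; rfl)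
  refine (add_le_add_right h1 _).trans_eq ?_
  rw [sum_add_distrib, sum_add_distrib, one_div_mul_one_div, Real.mul_self_sqrt hM.le]
  simp
  field_simp
  norm_num

end Entries

section QueryKernel

variable {X Y R : Type*} [DecidableEq X] [Fintype Y] [DecidableEq Y]
variable [NormedAddCommGroup R] [InnerProductSpace ℂ R]

/-- The kernel of `swapAt x` is tame. -/
theorem isTame_swapMatrix [Nonempty Y] :
    IsTame fun u v : Option Y => swapMatrix u v • (LinearMap.id : R →ₗ[ℂ] R) where
  contract a := (sum_norm_sq_swapMatrix a).le
  none_le y a := by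
    rw [LinearMap.smul_apply, norm_smul, norm_swapMatrix_some_none, LinearMap.id_apply]
    gcongr
    norm_num
  some_le y z h a := by
    rw [LinearMap.smul_apply, norm_smul, norm_swapMatrix_some_some_of_ne h.symm,
      LinearMap.id_apply]
    gcongr
    norm_num

/-- The kernel of an operation controlled by a register, conjugated by the map `swapAt` of that
register. -/
def queryKernel (U : Option Y → R →ₗᵢ[ℂ] R) (u r : Option Y) : R →ₗ[ℂ] R :=
  ∑ v, (swapMatrix u v * swapMatrix v r) • (U v).toLinearMap

theorem norm_queryKernel_le (U : Option Y → R →ₗᵢ[ℂ] R) (u r : Option Y) (a : R) :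
    ‖queryKernel U u r a‖ ≤ (∑ v, ‖swapMatrix u v * swapMatrix v r‖) * ‖a‖ := by
  rw [queryKernel, LinearMap.sum_apply, sum_mul]
  refine (norm_sum_le _ _).trans_eq (sum_congr rfl fun v _ => ?_)
  rw [LinearMap.smul_apply, norm_smul, LinearIsometry.coe_toLinearMap, LinearIsometry.norm_map]

theorem isTame_queryKernel [Nonempty Y] (U : Option Y → R →ₗᵢ[ℂ] R) :
    IsTame (queryKernel U) where
  contract a := by
    have h (u : Option Y) : ∑ r, queryKernel U u r (a r)
        = ∑ v, swapMatrix u v • U v (∑ r, swapMatrix v r • a r) := by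
      simp only [queryKernel, LinearMap.sum_apply, LinearMap.smul_apply, map_sum, map_smul,
        smul_sum, smul_smul, LinearIsometry.coe_toLinearMap]
      exact sum_comm
    simp only [h]
    rw [sum_norm_sq_swapMatrix]
    simp only [LinearIsometry.norm_map]
    exact (sum_norm_sq_swapMatrix a).le
  none_le y a := (norm_queryKernel_le U _ _ a).trans <|
    mul_le_mul_of_nonneg_right (sum_norm_swapMatrix_mul_none_le y) (norm_nonneg a)
  some_le y z h a := (norm_queryKernel_le U _ _ a).trans <|
    mul_le_mul_of_nonneg_right (sum_norm_swapMatrix_mul_some_le h) (norm_nonneg a)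

/-- The operation that applies `U u` if the register `x` holds `u`. -/
def controlledAt (x : X) (U : Option Y → R →ₗᵢ[ℂ] R) : Module.End ℂ (Database X Y → R) :=
  onRegister x fun u r => if u = r then (U u).toLinearMap else 0

theorem controlledAt_apply (x : X) (U : Option Y → R →ₗᵢ[ℂ] R) (φ : Database X Y → R)
    (D : Database X Y) : controlledAt x U φ D = U (D x) (φ D) := by
  rw [controlledAt, onRegister_apply,
    Fintype.sum_eq_single (D x) fun r hr => by rw [if_neg hr.symm, LinearMap.zero_apply],
    if_pos rfl, update_eq_self, LinearIsometry.coe_toLinearMap]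

theorem onRegister_queryKernel (x : X) (U : Option Y → R →ₗᵢ[ℂ] R) :
    onRegister x (queryKernel U) = swapAt x * controlledAt x U * swapAt x := by
  ext φ D
  simp only [Module.End.mul_apply, swapAt_apply, controlledAt_apply, onRegister_apply,
    queryKernel, LinearMap.sum_apply, LinearMap.smul_apply, map_sum, map_smul,
    smul_sum, smul_smul, LinearIsometry.coe_toLinearMap, update_self, update_idem]
  exact sum_comm

end QueryKernel

section SwapAll

variable {X Y R : Type*} [DecidableEq X] [Fintype Y] [DecidableEq Y]

section Module

variable [AddCommGroup R] [Module ℂ R]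

/-- The product of the maps `swapAt` over a list of registers. -/
def swapList (l : List X) : Module.End ℂ (Database X Y → R) :=
  (l.map swapAt).prod

theorem swapList_cons (x : X) (l : List X) :
    (swapList (x :: l) : Module.End ℂ (Database X Y → R)) = swapAt x * swapList l := by
  simp [swapList]

theorem swapList_perm {l l' : List X} (h : l.Perm l') :
    (swapList l : Module.End ℂ (Database X Y → R)) = swapList l' :=
  (h.map _).prod_eq' (List.pairwise_map.2 (List.pairwise_of_forall fun x z => commute_swapAt x z))

/-- Operations that act on the vectors only commute with the maps `swapAt`. -/
theorem swapList_map {S : Type*} [AddCommGroup S] [Module ℂ S] (l : List X) (T : R →ₗ[ℂ] S)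
    (φ : Database X Y → R) (D : Database X Y) :
    swapList l (fun D => T (φ D)) D = T (swapList l φ D) := by
  induction l generalizing D with
  | nil => rfl
  | cons x l ih =>
    simp only [swapList_cons, Module.End.mul_apply, swapAt_apply, map_sum, map_smul, ih]

/-- On the empty database, `swapList` prepares a uniform superposition in every register of the
list. -/
theorem swapList_indicator_none {l : List X} (hl : l.Nodup) (ψ : R) (D : Database X Y) :
    swapList l (Set.indicator {fun _ => none} fun _ => ψ) D
      = Set.indicator {D | ∀ z ∉ l, D z = none}
          (fun D => (l.map fun x => swapMatrix (D x) none).prod • ψ) D := by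
  induction l generalizing D with
  | nil =>
    have h : ({fun _ => none} : Set (Database X Y)) = {D | ∀ z ∉ ([] : List X), D z = none} := by
      ext D
      simp [funext_iff]
    rw [← h]
    simp [swapList]
  | cons x l ih =>
    obtain ⟨hx, hl⟩ := List.nodup_cons.1 hl
    rw [swapList_cons, Module.End.mul_apply, swapAt_apply, Fintype.sum_eq_single none]
    · rw [ih hl]
      have e1 : l.map (fun z => swapMatrix (update D x none z) none)
          = l.map fun z => swapMatrix (D z) none :=
        List.map_congr_left fun z hz => by rw [update_of_ne (ne_of_mem_of_not_mem hz hx)]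
      have e2 : (∀ z ∉ l, update D x none z = none) ↔ ∀ z ∉ x :: l, D z = none := by
        constructor
        · intro h z hz
          simp only [List.mem_cons, not_or] at hz
          have := h z hz.2
          rwa [update_of_ne hz.1] at this
        · intro h z hz
          rcases eq_or_ne z x with rfl | hzx
          · rw [update_self]
          · rw [update_of_ne hzx]
            exact h z (by simp [hzx, hz])
      by_cases h : ∀ z ∉ x :: l, D z = none
      · rw [Set.indicator_of_mem (Set.mem_ofPred.2 (e2.2 h)),
          Set.indicator_of_mem (Set.mem_ofPred.2 h), e1, smul_smul, List.map_cons, List.prod_cons]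
      · rw [Set.indicator_of_notMem fun h' => h (e2.1 (Set.mem_ofPred.1 h')),
          Set.indicator_of_notMem (mt Set.mem_ofPred.1 h), smul_zero]
    · intro v hv
      rw [ih hl, Set.indicator_of_notMem, smul_zero]
      intro h
      exact hv (by simpa using h x hx)

variable [Fintype X]

/-- Decompression of all registers. -/
def decompress : Module.End ℂ (Database X Y → R) :=
  swapList univ.toList

/-- The amplitude of a database in the decompression of the empty database. -/
def uniformAmplitude (D : Database X Y) : ℂ := ∏ x, swapMatrix (D x) none

theorem decompress_indicator_none (ψ : R) (D : Database X Y) :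
    decompress (Set.indicator {fun _ => none} fun _ => ψ) D = uniformAmplitude D • ψ := by
  rw [decompress, swapList_indicator_none (nodup_toList _), Set.indicator_of_mem (by simp),
    uniformAmplitude, Finset.prod_map_toList]

/-- The decompression of the empty database is the uniform superposition of all total functions. -/
theorem norm_sq_uniformAmplitude (H : X → Y) :
    ‖uniformAmplitude fun x => some (H x)‖ ^ 2 = 1 / Fintype.card (X → Y) := by
  rw [uniformAmplitude, norm_prod]
  simp only [norm_swapMatrix_some_none, prod_const, card_univ]
  rw [pow_right_comm, div_pow, Real.sq_sqrt (Nat.cast_nonneg _)]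
  simp

theorem decompress_eq_mul (x : X) : (decompress : Module.End ℂ (Database X Y → R))
    = swapList (univ.toList.erase x) * swapAt x := by
  rw [decompress, swapList_perm (List.perm_cons_erase (mem_toList.2 (mem_univ x))), swapList_cons]
  refine Commute.list_prod_right _ _ fun f hf => ?_
  obtain ⟨z, -, rfl⟩ := List.mem_map.1 hf
  exact commute_swapAt x z

end Module

variable [Fintype X] [NormedAddCommGroup R] [InnerProductSpace ℂ R]

/-- Decompression conjugates an operator with a query kernel to the controlled operation. -/
theorem decompress_mul_onRegister_queryKernel [Nonempty Y] (x : X) (U : Option Y → R →ₗᵢ[ℂ] R) :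
    decompress * onRegister x (queryKernel U) = controlledAt x U * decompress := by
  have h : Commute (controlledAt x U) (swapList (univ.toList.erase x)) := by
    refine Commute.list_prod_right _ _ fun f hf => ?_
    obtain ⟨z, hz, rfl⟩ := List.mem_map.1 hf
    exact commute_onRegister_swapAt
      (fun h => (nodup_toList univ).not_mem_erase (h ▸ hz)) _
  rw [decompress_eq_mul x, onRegister_queryKernel, mul_assoc, ← mul_assoc (swapAt x),
    ← mul_assoc (swapAt x), swapAt_mul_self, one_mul, ← mul_assoc, ← h.eq, mul_assoc]

theorem l2_swapList_le [Nonempty Y] (l : List X) (φ : Database X Y → R) :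
    l2 (swapList l φ) ≤ l2 φ := by
  have h : swapList l = onRegisters (Y := Y) (l.map fun x => (x, fun u v =>
      swapMatrix u v • (LinearMap.id : R →ₗ[ℂ] R))) := by
    rw [swapList, onRegisters, List.map_map]
    rfl
  rw [h]
  refine l2_onRegisters_le (fun p hp => ?_) φ
  obtain ⟨x, -, rfl⟩ := List.mem_map.1 hp
  exact isTame_swapMatrix

/-- For an event that depends on the registers in `s` only, decompressing the other registers is
irrelevant. -/
theorem l2_indicator_decompress_le [Nonempty Y] (s : Finset X) (E : Set (Database X Y))
    (hE : ∀ z ∉ s, ∀ D v, update D z v ∈ E ↔ D ∈ E) (φ : Database X Y → R) :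
    l2 (E.indicator (decompress φ)) ≤ l2 (E.indicator (swapList s.toList φ)) := by
  have hperm : (univ : Finset X).toList.Perm (sᶜ.toList ++ s.toList) := by
    refine (List.perm_ext_iff_of_nodup (nodup_toList _) ?_).2 ?_
    · refine (nodup_toList _).append (nodup_toList _) fun x hx hx' => ?_
      exact (mem_compl.1 (mem_toList.1 hx)) (mem_toList.1 hx')
    · intro x
      simp [em']
  have hcomm (l : List X) (hl : ∀ z ∈ l, z ∉ s) (ψ : Database X Y → R) :
      E.indicator (swapList l ψ) = swapList l (E.indicator ψ) := by
    induction l with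
    | nil => rfl
    | cons x l ih =>
      rw [swapList_cons, Module.End.mul_apply, Module.End.mul_apply,
        ← ih fun z hz => hl z (by simp [hz])]
      ext D
      classical
      simp only [Set.indicator_apply, swapAt_apply, hE x (hl x (by simp))]
      split_ifs <;> simp
  rw [decompress, swapList_perm hperm]
  have : (swapList (sᶜ.toList ++ s.toList) : Module.End ℂ (Database X Y → R))
      = swapList sᶜ.toList * swapList s.toList := by
    simp [swapList]
  rw [this, Module.End.mul_apply, hcomm _ (by simp)]
  exact l2_swapList_le _ _

end SwapAll

/-! ### The compressed run of an algorithm -/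

section Blocks

variable {X Y : Type*} {k d : ℕ}

/-- The response and work registers, without the query registers. -/
abbrev ResponseSpace (Y : Type*) (k d : ℕ) : Type _ :=
  EuclideanSpace ℂ ((Fin k → Y) × Fin d)

/-- The component of a state of the algorithm in which the query registers hold `x`. -/
def block (x : Fin k → X) : QSpace X Y k d →ₗ[ℂ] ResponseSpace Y k d where
  toFun ψ := WithLp.toLp 2 fun p => ψ (x, p)
  map_add' _ _ := rfl
  map_smul' _ _ := rfl

theorem block_apply (x : Fin k → X) (ψ : QSpace X Y k d) (p : (Fin k → Y) × Fin d) :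
    block x ψ p = ψ (x, p) := rfl

theorem ext_block {ψ ψ' : QSpace X Y k d} (h : ∀ x, block x ψ = block x ψ') : ψ = ψ' := by
  ext ⟨x, p⟩
  rw [← block_apply, h, block_apply]

theorem indicator_block {ι : Type*} (E : Set ι) (φ : ι → QSpace X Y k d) (x : Fin k → X) :
    (fun i => block x (E.indicator φ i)) = E.indicator fun i => block x (φ i) := by
  ext1 i
  by_cases hi : i ∈ E <;> simp [hi]

variable [Fintype X] [Fintype Y]

/-- The blocks are orthogonal to each other. -/
theorem l2_sq_eq_sum_block {ι : Type*} [Fintype ι] (φ : ι → QSpace X Y k d) :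
    l2 φ ^ 2 = ∑ x, l2 (fun i => block x (φ i)) ^ 2 := by
  simp only [l2_sq, EuclideanSpace.norm_sq_eq, block_apply, Fintype.sum_prod_type]
  exact sum_comm

theorem l2_le_of_block {ι : Type*} [Fintype ι] {φ ψ : ι → QSpace X Y k d} {c : ℝ} (hc : 0 ≤ c)
    (h : ∀ x, l2 (fun i => block x (φ i)) ≤ c * l2 fun i => block x (ψ i)) :
    l2 φ ≤ c * l2 ψ := by
  refine le_of_sq_le_sq ?_ (mul_nonneg hc (l2_nonneg _))
  rw [mul_pow, l2_sq_eq_sum_block, l2_sq_eq_sum_block, mul_sum]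
  refine sum_le_sum fun x _ => ?_
  rw [← mul_pow]
  exact pow_le_pow_left₀ (l2_nonneg _) (h x) 2

end Blocks

section Query

variable {X Y : Type*} [Fintype Y] [AddCommGroup Y] {k d : ℕ}

/-- The translation of the `j`-th response register by `v`; nothing happens for `none`. -/
def shiftAt (j : Fin k) (v : Option Y) : ResponseSpace Y k d →ₗᵢ[ℂ] ResponseSpace Y k d :=
  (LinearIsometryEquiv.piLpCongrLeft 2 ℂ ℂ <|
    Equiv.prodCongr (Equiv.addRight (Pi.single j (v.getD 0))) (Equiv.refl _)).toLinearIsometry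

theorem shiftAt_apply (j : Fin k) (v : Option Y) (ψ : ResponseSpace Y k d)
    (p : (Fin k → Y) × Fin d) :
    shiftAt j v ψ p = ψ (p.1 - Pi.single j (v.getD 0), p.2) := by
  rw [sub_eq_add_neg]
  rfl

theorem block_parallelQuery [Fintype X] (H : X → Y) (ψ : QSpace X Y k d) (x : Fin k → X)
    (p : (Fin k → Y) × Fin d) :
    block x (parallelQuery k d H ψ) p = block x ψ (fun j => p.1 j - H (x j), p.2) := rfl

/-- A database as a total function, with value `0` where it is undefined. -/
def Database.toFun (D : Database X Y) (x : X) : Y := (D x).getD 0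

variable [DecidableEq Y]

/-- The `k`-parallel query to the compressed oracle, for the content `x` of the query registers,
as a list of operators on single registers of the database. The same register occurs several times
if `x` is not injective. -/
def queryList (x : Fin k → X) : List (X × (Option Y → Option Y →
    ResponseSpace Y k d →ₗ[ℂ] ResponseSpace Y k d)) :=
  (List.finRange k).map fun j => (x j, queryKernel (shiftAt j))

theorem isTame_of_mem_queryList {x : Fin k → X} {p : X × (Option Y → Option Y →
    ResponseSpace Y k d →ₗ[ℂ] ResponseSpace Y k d)} (hp : p ∈ queryList x) : IsTame p.2 := by
  obtain ⟨j, -, rfl⟩ := List.mem_map.1 hp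
  exact isTame_queryKernel _

theorem mem_map_fst_queryList {x : Fin k → X} {z : X} :
    z ∈ (queryList x : List (X × (Option Y → Option Y →
      ResponseSpace Y k d →ₗ[ℂ] ResponseSpace Y k d))).map Prod.fst ↔ ∃ j, x j = z := by
  simp [queryList]

variable [DecidableEq X]

/-- The `k`-parallel query to the compressed oracle. -/
def compressedQuery (φ : Database X Y → QSpace X Y k d) (D : Database X Y) : QSpace X Y k d :=
  WithLp.toLp 2 fun b => onRegisters (queryList b.1) (fun D => block b.1 (φ D)) D b.2

theorem block_compressedQuery (φ : Database X Y → QSpace X Y k d) (x : Fin k → X) :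
    (fun D => block x (compressedQuery φ D))
      = onRegisters (queryList x) fun D => block x (φ D) := rfl

theorem compressedQuery_add (φ ψ : Database X Y → QSpace X Y k d) :
    compressedQuery (φ + ψ) = compressedQuery φ + compressedQuery ψ := by
  ext1 D
  refine ext_block fun x => ?_
  have h := block_compressedQuery (φ + ψ) x
  simp only [Pi.add_apply, map_add] at h
  rw [← Pi.add_def, map_add] at h
  exact congrFun h D

variable [Fintype X]

theorem decompress_onRegisters_queryList (x : Fin k → X)
    (φ : Database X Y → ResponseSpace Y k d) (D : Database X Y) (p : (Fin k → Y) × Fin d) :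
    decompress (onRegisters (queryList x) φ) D p
      = decompress φ D (fun j => p.1 j - D.toFun (x j), p.2) := by
  have key (l : List (Fin k)) (p : (Fin k → Y) × Fin d) :
      decompress (onRegisters (l.map fun j => (x j, queryKernel (shiftAt j))) φ) D p
        = decompress φ D
            (p.1 - (l.map fun j => Pi.single j (D.toFun (x j))).sum, p.2) := by
    induction l generalizing p with
    | nil => simp [onRegisters]
    | cons j l ih =>
      rw [List.map_cons, onRegisters_cons, ← Module.End.mul_apply,
        decompress_mul_onRegister_queryKernel, Module.End.mul_apply, controlledAt_apply,
        shiftAt_apply, ih, List.map_cons, List.sum_cons, sub_sub]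
      rfl
  rw [queryList, key]
  rw [← Fin.sum_univ_def, univ_sum_single fun j => D.toFun (x j)]
  rfl

/-- Decompression turns queries to the compressed oracle into queries to the oracle. -/
theorem decompress_compressedQuery (φ : Database X Y → QSpace X Y k d) (D : Database X Y) :
    decompress (compressedQuery φ) D = parallelQuery k d D.toFun (decompress φ D) := by
  refine ext_block fun x => ?_
  ext p
  rw [block_parallelQuery, decompress, ← swapList_map, block_compressedQuery, ← swapList_map]
  exact decompress_onRegisters_queryList x _ D p

theorem l2_compressedQuery_le (φ : Database X Y → QSpace X Y k d) :
    l2 (compressedQuery φ) ≤ l2 φ := by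
  rw [← one_mul (l2 φ)]
  refine l2_le_of_block zero_le_one fun x => ?_
  rw [block_compressedQuery, one_mul]
  exact l2_onRegisters_le (fun p hp => isTame_of_mem_queryList hp) _

/-- A query changes the registers of the queried points only. -/
theorem exists_of_compressedQuery_ne_zero {φ : Database X Y → QSpace X Y k d} {D : Database X Y}
    (h : compressedQuery φ D ≠ 0) :
    ∃ x : Fin k → X, ∃ D', φ D' ≠ 0 ∧ ∀ z, D' z ≠ D z → ∃ j, x j = z := by
  obtain ⟨x, hx⟩ : ∃ x, block x (compressedQuery φ D) ≠ 0 := by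
    by_contra! h'
    exact h (ext_block fun x => (h' x).trans (map_zero _).symm)
  obtain ⟨D', hD', hz⟩ := exists_of_onRegisters_ne_zero
    (show onRegisters (queryList x) (fun D => block x (φ D)) D ≠ 0 from hx)
  exact ⟨x, D', fun h0 => hD' (by rw [h0, map_zero]), fun z hne =>
    mem_map_fst_queryList.1 (hz z hne)⟩

/-- The transition bound for a compressed query. The set `L x D` of values may depend on the queried
points `x` and on the content of `D` elsewhere. -/
theorem l2_indicator_compressedQuery_le {L : (Fin k → X) → Database X Y → Finset Y} {m : ℕ}
    (hm : ∀ x D, #(L x D) ≤ m) (hL : ∀ x j D r, L x (update D (x j) r) = L x D)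
    {P Q : Set (Database X Y)} {φ : Database X Y → QSpace X Y k d} (hφ : ∀ D, φ D ≠ 0 → D ∈ P)
    (hPQ : ∀ x : Fin k → X, ∀ D ∈ Q, ∀ D' ∈ P, (∀ z, D' z ≠ D z → ∃ j, x j = z) →
      ∃ z, D' z ≠ D z ∧ ∃ y ∈ L x D, D z = some y) :
    l2 (Q.indicator (compressedQuery φ))
      ≤ ((1 + √(20 * (m / Fintype.card Y))) ^ k - 1) * l2 φ := by
  refine l2_le_of_block
    (sub_nonneg.2 (one_le_pow₀ (le_add_of_nonneg_right (Real.sqrt_nonneg _)))) fun x => ?_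
  rw [indicator_block, block_compressedQuery]
  have h := l2_indicator_onRegisters_le (l := queryList x) (P := P) (Q := Q)
    (φ := fun D => block x (φ D)) (fun p hp => isTame_of_mem_queryList hp) (hm x)
    (fun p hp D r => by
      obtain ⟨j, -, rfl⟩ := List.mem_map.1 hp
      exact hL x j D r)
    (fun D hD => hφ D fun h0 => hD (by rw [h0, map_zero]))
    (fun D hD D' hD' hz => hPQ x D hD D' hD' fun z hne => mem_map_fst_queryList.1 (hz z hne))
  simpa [queryList] using h

end Query

/-! ### Chains in databases -/

section Chains

variable {X Y : Type*}

/-- The databases that contain a chain with `n` links. -/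
def chainSet (rel : Y → X → Prop) (n : ℕ) : Set (Database X Y) :=
  {D | ∃ c : Fin (n + 1) → X, ∀ i : Fin n, ∃ y, D (c i.castSucc) = some y ∧ rel y (c i.succ)}

/-- The points at which a database is defined. -/
def Database.dom [Fintype X] (D : Database X Y) : Finset X := univ.filter fun x => (D x).isSome

theorem Database.mem_dom [Fintype X] {D : Database X Y} {x : X} :
    x ∈ D.dom ↔ ∃ y, D x = some y := by
  simp [Database.dom, Option.isSome_iff_exists]

theorem Database.dom_subset [Fintype X] [DecidableEq X] {D D' : Database X Y} {k : ℕ}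
    {x : Fin k → X}
    (h : ∀ z, D' z ≠ D z → ∃ j, x j = z) : D.dom ⊆ D'.dom ∪ univ.image x := by
  intro z hz
  by_cases hne : D' z = D z
  · exact mem_union_left _ (Database.mem_dom.2 (hne ▸ Database.mem_dom.1 hz))
  · obtain ⟨j, rfl⟩ := h z hne
    exact mem_union_right _ (mem_image_of_mem _ (mem_univ j))

theorem Database.card_dom_union_le [Fintype X] [DecidableEq X] {D D' : Database X Y} {k : ℕ}
    {x : Fin k → X}
    (h : ∀ z, D' z ≠ D z → ∃ j, x j = z) : #(D.dom ∪ univ.image x) ≤ #D'.dom + k := by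
  have h1 : #(univ.image x) ≤ k := by simpa using card_image_le (s := univ) (f := x)
  calc _ ≤ #(D'.dom ∪ univ.image x) :=
        card_le_card (union_subset (Database.dom_subset h) subset_union_right)
    _ ≤ _ := (card_union_le _ _).trans (by gcongr)

variable [Fintype Y]

/-- The values that are related to `x`. -/
def relFinset (rel : Y → X → Prop) (x : X) : Finset Y :=
  (Set.toFinite {y | rel y x}).toFinset

theorem mem_relFinset {rel : Y → X → Prop} {x : X} {y : Y} : y ∈ relFinset rel x ↔ rel y x := by
  simp [relFinset]

variable [Fintype X]

theorem card_relFinset_le (rel : Y → X → Prop) (x : X) : #(relFinset rel x) ≤ maxRelCard rel := by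
  rw [relFinset, ← Set.ncard_eq_toFinset_card]
  exact le_sup (f := fun x : X => Set.ncard {y : Y | rel y x}) (mem_univ x)

theorem card_biUnion_relFinset_le [DecidableEq Y] (rel : Y → X → Prop) (s : Finset X) {n : ℕ}
    (hs : #s ≤ n) : #(s.biUnion (relFinset rel)) ≤ n * maxRelCard rel :=
  (card_biUnion_le_card_mul _ _ _ fun x _ => card_relFinset_le rel x).trans
    (Nat.mul_le_mul_right _ hs)

end Chains

section Run

variable {X Y : Type*} [Fintype X] [DecidableEq X] [Fintype Y] [DecidableEq Y] [AddCommGroup Y]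
variable {k d : ℕ}

/-- If a query creates a chain with one more link, then it writes a value that is related to a point
which is queried or already in the database. -/
theorem l2_indicator_chainSet_compressedQuery_le (rel : Y → X → Prop) {s n : ℕ}
    (hn : s * k + k ≤ n) {φ : Database X Y → QSpace X Y k d}
    (hφ : ∀ D, φ D ≠ 0 → D ∉ chainSet rel (s + 1) ∧ #D.dom ≤ s * k) :
    l2 ((chainSet rel (s + 2)).indicator (compressedQuery φ))
      ≤ ((1 + √(20 * ((n * maxRelCard rel : ℕ) / Fintype.card Y))) ^ k - 1) * l2 φ := by
  -- Truncation to small databases makes the bound on the number of values unconditional.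
  refine l2_indicator_compressedQuery_le (P := {D | D ∉ chainSet rel (s + 1) ∧ #D.dom ≤ s * k})
    (L := fun x D => if #(D.dom ∪ univ.image x) ≤ n then
      (D.dom ∪ univ.image x).biUnion (relFinset rel) else ∅) ?_ ?_ hφ ?_
  · intro x D
    split_ifs with h
    · exact card_biUnion_relFinset_le rel _ h
    · simp
  · intro x j (D : Database X Y) r
    have h : Database.dom (update D (x j) r) ∪ univ.image x = D.dom ∪ univ.image x := by
      ext z
      simp only [mem_union, Database.mem_dom, mem_image, mem_univ, true_and]
      rcases eq_or_ne z (x j) with rfl | hz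
      · simp
      · rw [update_of_ne hz]
    simp only [h]
  · rintro x D ⟨c, hc⟩ D' ⟨hD', hcard⟩ hz
    -- Without its last link, the chain `c` has `s + 1` links, so one of them fails in `D'`. Its end
    -- point lies in the domain of `D`, because the next link starts there.
    obtain ⟨i, hi⟩ : ∃ i : Fin (s + 1), ¬ ∃ y, D' (c i.castSucc.castSucc) = some y ∧
        rel y (c i.succ.castSucc) := by
      by_contra! h
      exact hD' ⟨fun i => c i.castSucc, h⟩
    obtain ⟨y, hy, hrel⟩ := hc i.castSucc
    refine ⟨_, fun heq => hi ⟨y, heq.trans hy, hrel⟩, y, ?_, hy⟩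
    rw [if_pos (((Database.card_dom_union_le hz).trans (by gcongr)).trans hn)]
    exact mem_biUnion.2 ⟨_, mem_union_left _ (Database.mem_dom.2 ((hc i.succ).imp fun _ h => h.1)),
      mem_relFinset.2 hrel⟩

/-- Guessing the end of a chain: if the database contains no chain with `n` links, then the
decompressed oracle is unlikely to satisfy the links of a given sequence `c`. -/
theorem l2_indicator_decompress_chain_le {R : Type*} [NormedAddCommGroup R]
    [InnerProductSpace ℂ R] (rel : Y → X → Prop) {n : ℕ} (c : Fin (n + 1) → X)
    {φ : Database X Y → R} (hφ : ∀ D, φ D ≠ 0 → D ∉ chainSet rel n) :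
    l2 (Set.indicator {D | ∀ i : Fin n, ∃ y, D (c i.castSucc) = some y ∧ rel y (c i.succ)}
        (decompress φ))
      ≤ ((1 + √(20 * ((n * maxRelCard rel : ℕ) / Fintype.card Y))) ^ n - 1) * l2 φ := by
  set s : Finset X := univ.image fun i : Fin n => c i.castSucc with hs
  have hmem (i : Fin n) : c i.castSucc ∈ s := mem_image_of_mem _ (mem_univ i)
  refine (l2_indicator_decompress_le s _ (fun z hz D v => ?_) φ).trans ?_
  · refine forall_congr' fun i => ?_
    rw [update_of_ne (ne_of_mem_of_not_mem (hmem i) hz)]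
  have hl : swapList s.toList = onRegisters (Y := Y) (s.toList.map fun x => (x, fun u v =>
      swapMatrix u v • (LinearMap.id : R →ₗ[ℂ] R))) := by
    rw [swapList, onRegisters, List.map_map]
    rfl
  rw [hl]
  refine (l2_indicator_onRegisters_le (P := (chainSet rel n)ᶜ)
    (L := fun _ => (univ.image fun i : Fin n => c i.succ).biUnion (relFinset rel))
    (m := n * maxRelCard rel) ?_ ?_ (fun _ _ _ _ => rfl) hφ ?_).trans ?_
  · intro p hp
    obtain ⟨x, -, rfl⟩ := List.mem_map.1 hp
    exact isTame_swapMatrix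
  · exact fun D => card_biUnion_relFinset_le rel _ (card_image_le.trans (by simp))
  · intro D hD D' hD' hz
    obtain ⟨i, hi⟩ : ∃ i : Fin n, ¬ ∃ y, D' (c i.castSucc) = some y ∧ rel y (c i.succ) := by
      by_contra! h
      exact hD' ⟨c, h⟩
    obtain ⟨y, hy, hrel⟩ := hD i
    exact ⟨_, fun heq => hi ⟨y, heq.trans hy, hrel⟩, y,
      mem_biUnion.2 ⟨_, mem_image_of_mem _ (mem_univ i), mem_relFinset.2 hrel⟩, hy⟩
  · have hcard : #s ≤ n := card_image_le.trans (by simp)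
    rw [List.length_map, length_toList]
    gcongr
    · exact l2_nonneg φ
    · exact le_add_of_nonneg_right (Real.sqrt_nonneg _)

namespace ParallelQueryAlgorithm

variable {q ℓ : ℕ}

/-- The state after `s ≤ q` rounds of interaction with the compressed oracle, which starts with the
empty database. -/
def compressedState (A : ParallelQueryAlgorithm X Y k q ℓ) :
    (s : ℕ) → s ≤ q → Database X Y → QSpace X Y k A.dim
  | 0, _ => Set.indicator {fun _ => none} fun _ => A.init
  | s + 1, h => fun D =>
      A.U ⟨s, h⟩ (compressedQuery (compressedState A s (Nat.le_of_succ_le h)) D)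

/-- Decompression of the run with the compressed oracle yields the superposition, over all oracles,
of the runs of the algorithm. -/
theorem decompress_compressedState (A : ParallelQueryAlgorithm X Y k q ℓ) (s : ℕ) (hs : s ≤ q)
    (D : Database X Y) :
    decompress (A.compressedState s hs) D = uniformAmplitude D • A.state D.toFun s hs := by
  induction s generalizing D with
  | zero => exact decompress_indicator_none A.init D
  | succ s ih =>
    have h := swapList_map univ.toList (A.U ⟨s, hs⟩).toLinearEquiv.toLinearMap
      (compressedQuery (A.compressedState s (Nat.le_of_succ_le hs))) D
    refine h.trans ?_
    change A.U ⟨s, hs⟩ (decompress _ D) = _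
    rw [decompress_compressedQuery, ih, map_smul, map_smul]
    rfl

theorem l2_compressedState_le (A : ParallelQueryAlgorithm X Y k q ℓ) (s : ℕ) (hs : s ≤ q) :
    l2 (A.compressedState s hs) ≤ 1 := by
  induction s with
  | zero =>
    rw [← A.norm_init, ← one_mul ‖A.init‖]
    have : l2 (fun _ : Unit => A.init) = ‖A.init‖ := by
      rw [← sq_eq_sq₀ (l2_nonneg _) (norm_nonneg _), l2_sq]
      simp
    rw [← this, one_mul]
    refine l2_le ?_
    classical
    simp [compressedState, Set.indicator_apply, apply_ite, ite_pow]
  | succ s ih =>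
    refine le_trans (l2_le ?_) ((l2_compressedQuery_le _).trans (ih (Nat.le_of_succ_le hs)))
    simp only [compressedState, LinearIsometryEquiv.norm_map]
    exact le_rfl

theorem card_dom_le_of_compressedState_ne_zero (A : ParallelQueryAlgorithm X Y k q ℓ) (s : ℕ)
    (hs : s ≤ q) {D : Database X Y} (h : A.compressedState s hs D ≠ 0) : #D.dom ≤ s * k := by
  induction s generalizing D with
  | zero =>
    have hD : D = fun _ => none := by
      by_contra hne
      exact h (Set.indicator_of_notMem (s := {fun _ => none}) hne _)
    simp [hD, Database.dom]
  | succ s ih =>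
    obtain ⟨x, D', hD', hz⟩ := exists_of_compressedQuery_ne_zero fun h0 => h
      ((congrArg (A.U ⟨s, hs⟩) h0).trans (map_zero _))
    have := ih _ hD'
    rw [Nat.succ_mul]
    exact (card_le_card subset_union_left).trans
      ((Database.card_dom_union_le hz).trans (by gcongr))

/-- The amplitude of the databases with a chain that is longer than the number of rounds. -/
theorem l2_indicator_chainSet_compressedState_le (A : ParallelQueryAlgorithm X Y k q ℓ)
    (rel : Y → X → Prop) (s : ℕ) (hs : s ≤ q) :
    l2 ((chainSet rel (s + 1)).indicator (A.compressedState s hs))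
      ≤ s * ((1 + √(20 * ((q * k * maxRelCard rel : ℕ) / Fintype.card Y))) ^ k - 1) := by
  set c := (1 + √(20 * ((q * k * maxRelCard rel : ℕ) / Fintype.card Y))) ^ k - 1 with hc
  have hc0 : 0 ≤ c := sub_nonneg.2 (one_le_pow₀ (le_add_of_nonneg_right (Real.sqrt_nonneg _)))
  induction s with
  | zero =>
    have : (chainSet rel 1).indicator (A.compressedState 0 hs) = 0 := by
      refine Set.indicator_eq_zero.2 (Set.disjoint_left.2 fun D hD hD' => ?_)
      have hD : D = fun _ => none := by
        by_contra hne
        exact hD (Set.indicator_of_notMem (s := {fun _ => none}) hne _)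
      obtain ⟨x, hx⟩ := hD'
      obtain ⟨y, hy, -⟩ := hx 0
      simp [hD] at hy
    simp [this, l2]
  | succ s ih =>
    set φ := A.compressedState s (Nat.le_of_succ_le hs) with hφ
    have h1 : l2 ((chainSet rel (s + 2)).indicator (A.compressedState (s + 1) hs))
        ≤ l2 ((chainSet rel (s + 2)).indicator (compressedQuery φ)) := by
      refine l2_le (sum_le_sum fun D _ => ?_)
      by_cases hD : D ∈ chainSet rel (s + 2)
      · rw [Set.indicator_of_mem hD, Set.indicator_of_mem hD, compressedState,
          LinearIsometryEquiv.norm_map]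
      · rw [Set.indicator_of_notMem hD, Set.indicator_of_notMem hD]
    have h2 : l2 ((chainSet rel (s + 2)).indicator
        (compressedQuery ((chainSet rel (s + 1))ᶜ.indicator φ))) ≤ c := by
      refine (l2_indicator_chainSet_compressedQuery_le rel (s := s) (n := q * k) ?_ ?_).trans ?_
      · rw [← Nat.succ_mul]
        exact Nat.mul_le_mul_right _ hs
      · intro D hD
        have hD' := Set.mem_of_indicator_ne_zero hD
        rw [Set.indicator_of_mem hD'] at hD
        exact ⟨hD', A.card_dom_le_of_compressedState_ne_zero s _ hD⟩
      · exact mul_le_of_le_one_right hc0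
          ((l2_indicator_le _ _).trans (A.l2_compressedState_le _ _))
    have h3 : l2 ((chainSet rel (s + 2)).indicator
        (compressedQuery ((chainSet rel (s + 1)).indicator φ))) ≤ s * c :=
      (l2_indicator_le _ _).trans ((l2_compressedQuery_le _).trans (ih _))
    rw [← Set.indicator_compl_add_self (chainSet rel (s + 1)) φ, compressedQuery_add,
      Set.indicator_add'] at h1
    have h4 := l2_add_le ((chainSet rel (s + 2)).indicator
        (compressedQuery ((chainSet rel (s + 1))ᶜ.indicator φ))) ((chainSet rel (s + 2)).indicator
        (compressedQuery ((chainSet rel (s + 1)).indicator φ)))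
    push_cast
    linarith

end ParallelQueryAlgorithm

end Run

/-! ### The success probability -/

namespace ParallelQueryAlgorithm

variable {X Y : Type*} [Fintype X] [DecidableEq X] [Fintype Y] [DecidableEq Y] {k q : ℕ}

/-- The databases that satisfy all links of the chain that is output for the measured label `b`. -/
def linkSet (A : ParallelQueryAlgorithm X Y k q (q + 2)) (rel : Y → X → Prop)
    (b : QLabel X Y k A.dim) : Set (Database X Y) :=
  {D | ∀ i : Fin (q + 1), ∃ y, D (A.output b i.castSucc) = some y ∧ rel y (A.output b i.succ)}

/-- The amplitudes, after decompression, of the measured labels and databases for which the output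
is a chain. -/
def successAmplitude (A : ParallelQueryAlgorithm X Y k q (q + 2)) (rel : Y → X → Prop)
    (φ : Database X Y → QSpace X Y k A.dim) (p : QLabel X Y k A.dim × Database X Y) : ℂ :=
  (A.linkSet rel p.1).indicator (decompress fun D => φ D p.1) p.2

theorem successAmplitude_add (A : ParallelQueryAlgorithm X Y k q (q + 2)) (rel : Y → X → Prop)
    (φ ψ : Database X Y → QSpace X Y k A.dim) :
    A.successAmplitude rel (φ + ψ) = A.successAmplitude rel φ + A.successAmplitude rel ψ := by
  ext p
  have h : (fun D => (φ + ψ) D p.1) = (fun D => φ D p.1) + fun D => ψ D p.1 := rfl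
  rw [Pi.add_apply, successAmplitude, h, map_add, Set.indicator_add']
  rfl

theorem l2_successAmplitude_le_of_forall (A : ParallelQueryAlgorithm X Y k q (q + 2))
    (rel : Y → X → Prop) {φ : Database X Y → QSpace X Y k A.dim} {c : ℝ} (hc : 0 ≤ c)
    (h : ∀ b, l2 ((A.linkSet rel b).indicator (decompress fun D => φ D b))
      ≤ c * l2 fun D => φ D b) :
    l2 (A.successAmplitude rel φ) ≤ c * l2 φ := by
  refine l2_le_mul hc ?_
  simp only [EuclideanSpace.norm_sq_eq]
  rw [Fintype.sum_prod_type]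
  conv_rhs => rw [sum_comm, mul_sum]
  refine sum_le_sum fun b _ => ?_
  have := pow_le_pow_left₀ (l2_nonneg _) (h b) 2
  rwa [mul_pow, l2_sq, l2_sq] at this

variable [AddCommGroup Y]

theorem l2_successAmplitude_le (A : ParallelQueryAlgorithm X Y k q (q + 2)) (rel : Y → X → Prop)
    (φ : Database X Y → QSpace X Y k A.dim) : l2 (A.successAmplitude rel φ) ≤ l2 φ := by
  rw [← one_mul (l2 φ)]
  refine A.l2_successAmplitude_le_of_forall rel zero_le_one fun b => ?_
  rw [one_mul]
  exact (l2_indicator_le _ _).trans (l2_swapList_le _ _)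

theorem l2_successAmplitude_le_of_notMem (A : ParallelQueryAlgorithm X Y k q (q + 2))
    (rel : Y → X → Prop) {φ : Database X Y → QSpace X Y k A.dim}
    (hφ : ∀ D, φ D ≠ 0 → D ∉ chainSet rel (q + 1)) :
    l2 (A.successAmplitude rel φ)
      ≤ ((1 + √(20 * (((q + 1) * maxRelCard rel : ℕ) / Fintype.card Y))) ^ (q + 1) - 1)
        * l2 φ := by
  refine A.l2_successAmplitude_le_of_forall rel
    (sub_nonneg.2 (one_le_pow₀ (le_add_of_nonneg_right (Real.sqrt_nonneg _)))) fun b => ?_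
  refine l2_indicator_decompress_chain_le rel (A.output b) fun D hD => hφ D fun h0 => hD ?_
  rw [h0]
  rfl

/-- The Born rule, averaged over all oracles, in terms of the compressed run. -/
theorem successProb_le_l2_sq (A : ParallelQueryAlgorithm X Y k q (q + 2)) (rel : Y → X → Prop) :
    A.successProb (IsChainFor rel)
      ≤ l2 (A.successAmplitude rel (A.compressedState q le_rfl)) ^ 2 := by
  classical
  have happ (b : QLabel X Y k A.dim) (D : Database X Y) :
      decompress (fun D => A.compressedState q le_rfl D b) D
        = uniformAmplitude D * A.finalState D.toFun b := by
    have h := swapList_map univ.toList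
      (EuclideanSpace.proj b : QSpace X Y k A.dim →L[ℂ] ℂ).toLinearMap
      (A.compressedState q le_rfl) D
    refine h.trans ?_
    change decompress (A.compressedState q le_rfl) D b = _
    rw [decompress_compressedState]
    rfl
  have hH (H : X → Y) : A.outputProb H (IsChainFor rel H) / (Fintype.card (X → Y) : ℝ)
      = ∑ b, ‖A.successAmplitude rel (A.compressedState q le_rfl)
          (b, fun x => some (H x))‖ ^ 2 := by
    rw [outputProb, sum_div]
    refine sum_congr rfl fun b _ => ?_
    have hiff : IsChainFor rel H (A.output b) ↔ (fun x => some (H x)) ∈ A.linkSet rel b := by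
      simp [IsChainFor, linkSet]
    rw [successAmplitude]
    by_cases h : IsChainFor rel H (A.output b)
    · rw [if_pos h, Set.indicator_of_mem (hiff.1 h), happ, norm_mul, mul_pow,
        norm_sq_uniformAmplitude, div_eq_inv_mul, one_div]
      rfl
    · rw [if_neg h, Set.indicator_of_notMem (mt hiff.2 h)]
      simp
  rw [successProb, sum_div, l2_sq, Fintype.sum_prod_type_right]
  simp only [hH]
  have hinj : Injective fun (H : X → Y) (x : X) => some (H x) := fun H H' h =>
    funext fun x => Option.some_injective _ (congrFun h x)
  rw [← sum_image (f := fun D : Database X Y =>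
    ∑ b, ‖A.successAmplitude rel (A.compressedState q le_rfl) (b, D)‖ ^ 2) hinj.injOn]
  exact sum_le_sum_of_subset_of_nonneg (subset_univ _) fun D _ _ =>
    sum_nonneg fun b _ => sq_nonneg _

/-- The final compressed state is split into the part with a chain of `q + 1` links and the part
without one. -/
theorem successProb_le (A : ParallelQueryAlgorithm X Y k q (q + 2)) (rel : Y → X → Prop) :
    A.successProb (IsChainFor rel)
      ≤ (q * ((1 + √(20 * ((q * k * maxRelCard rel : ℕ) / Fintype.card Y))) ^ k - 1)
        + ((1 + √(20 * (((q + 1) * maxRelCard rel : ℕ) / Fintype.card Y))) ^ (q + 1) - 1)) ^ 2 := by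
  refine (A.successProb_le_l2_sq rel).trans (pow_le_pow_left₀ (l2_nonneg _) ?_ 2)
  set φ := A.compressedState q le_rfl with hφ
  rw [← Set.indicator_self_add_compl (chainSet rel (q + 1)) φ, successAmplitude_add]
  refine (l2_add_le _ _).trans (add_le_add ?_ ?_)
  · exact (A.l2_successAmplitude_le rel _).trans
      (A.l2_indicator_chainSet_compressedState_le rel q le_rfl)
  · refine (A.l2_successAmplitude_le_of_notMem rel fun D hD =>
      Set.mem_of_indicator_ne_zero hD).trans (mul_le_of_le_one_right ?_ ?_)
    · exact sub_nonneg.2 (one_le_pow₀ (le_add_of_nonneg_right (Real.sqrt_nonneg _)))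
    · exact (l2_indicator_le _ _).trans (A.l2_compressedState_le _ _)

theorem successProb_le_one (A : ParallelQueryAlgorithm X Y k q (q + 2)) (rel : Y → X → Prop) :
    A.successProb (IsChainFor rel) ≤ 1 :=
  (A.successProb_le_l2_sq rel).trans <| pow_le_one₀ (l2_nonneg _) <|
    (A.l2_successAmplitude_le rel _).trans (A.l2_compressedState_le _ _)

end ParallelQueryAlgorithm

/-! ### Estimates -/

/-- The constant `10` of the bound leaves room for the constant `20` of the transitions, since
`(e - 1) √20 ≤ e √10`. -/
theorem one_add_sqrt_pow_sub_one_le {z : ℝ} (hz : 0 ≤ z) (n : ℕ)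
    (h : n * Real.exp 1 * √(10 * z) ≤ 1) :
    (1 + √(20 * z)) ^ n - 1 ≤ n * Real.exp 1 * √(10 * z) := by
  set t := √(20 * z) with ht
  set r := √(10 * z) with hr
  have he : 2.7 ≤ Real.exp 1 := by linarith [Real.exp_one_gt_d9]
  have he' : Real.exp 1 ≤ 2.72 := by linarith [Real.exp_one_lt_d9]
  have hr0 : 0 ≤ r := Real.sqrt_nonneg _
  have ht0 : 0 ≤ t := Real.sqrt_nonneg _
  -- `t = √2 r ≤ 1.5 r`
  have htr : t ≤ 1.5 * r := by
    refine Real.sqrt_le_iff.2 ⟨by positivity, ?_⟩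
    rw [mul_pow, hr, Real.sq_sqrt (by positivity)]
    nlinarith
  have hn : (0 : ℝ) ≤ n := Nat.cast_nonneg n
  have hnr : n * r * 2.7 ≤ 1 := by nlinarith [mul_nonneg hn hr0]
  have hnt : n * t ≤ 1.5 * (n * r) := by nlinarith
  have h0 : 0 ≤ n * t := by positivity
  have h1 : n * t ≤ 1 := by nlinarith
  have h2 : (1 + t) ^ n ≤ Real.exp (n * t) := by
    rw [Real.exp_nat_mul]
    exact pow_le_pow_left₀ (by positivity) (by linarith [Real.add_one_le_exp t]) n
  -- convexity of the exponential function on `[0, 1]`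
  have h3 : Real.exp (n * t) ≤ 1 + (Real.exp 1 - 1) * (n * t) := by
    have := convexOn_exp.2 (Set.mem_univ 0) (Set.mem_univ 1) (sub_nonneg.2 h1) h0
      (sub_add_cancel 1 (n * t))
    simp only [smul_eq_mul, mul_zero, mul_one, zero_add, Real.exp_zero] at this
    linarith
  nlinarith [mul_nonneg hn hr0]

theorem ParallelQueryAlgorithm.successProb_le_add_sq {X Y : Type*} [Fintype X] [DecidableEq X]
    [Fintype Y] [DecidableEq Y] [AddCommGroup Y] {k q : ℕ}
    (A : ParallelQueryAlgorithm X Y k q (q + 2)) (rel : Y → X → Prop) :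
    A.successProb (IsChainFor rel)
      ≤ ((q : ℝ) * k * Real.exp 1 * √(10 * q * k * maxRelCard rel / Fintype.card Y)
        + Real.exp 1 * ((q : ℝ) + 2)
          * √(10 * maxRelCard rel * ((q : ℝ) + 2) / Fintype.card Y)) ^ 2 := by
  set T := maxRelCard rel
  set M := Fintype.card Y
  set z₁ : ℝ := (q * k * T : ℕ) / M with hz₁
  set z₂ : ℝ := ((q + 1) * T : ℕ) / M with hz₂
  have e₁ : (q : ℝ) * k * Real.exp 1 * √(10 * q * k * T / M)
      = q * (k * Real.exp 1 * √(10 * z₁)) := by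
    rw [show (10 : ℝ) * q * k * T / M = 10 * z₁ by rw [hz₁]; push_cast; ring]
    ring
  have e₂ : ((q + 1 : ℕ) : ℝ) * Real.exp 1 * √(10 * z₂)
      ≤ Real.exp 1 * ((q : ℝ) + 2) * √(10 * T * ((q : ℝ) + 2) / M) := by
    rw [mul_comm ((q + 1 : ℕ) : ℝ)]
    gcongr
    · push_cast
      linarith
    · rw [hz₂, ← mul_div_assoc]
      gcongr ?_ / _
      push_cast
      nlinarith [Nat.cast_nonneg (α := ℝ) T]
  rw [e₁]
  have n₁ : 0 ≤ q * (k * Real.exp 1 * √(10 * z₁)) := by positivity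
  have n₂ : 0 ≤ ((q + 1 : ℕ) : ℝ) * Real.exp 1 * √(10 * z₂) := by positivity
  -- If one of the two terms is at least `1`, then the bound is trivial.
  by_cases h₁ : 1 ≤ q * (k * Real.exp 1 * √(10 * z₁))
  · exact (A.successProb_le_one rel).trans (one_le_pow₀ (by linarith))
  by_cases h₂ : 1 ≤ ((q + 1 : ℕ) : ℝ) * Real.exp 1 * √(10 * z₂)
  · exact (A.successProb_le_one rel).trans (one_le_pow₀ (by linarith))
  push Not at h₁ h₂
  have b₁ : q * ((1 + √(20 * z₁)) ^ k - 1) ≤ q * (k * Real.exp 1 * √(10 * z₁)) := by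
    rcases Nat.eq_zero_or_pos q with rfl | hq
    · simp
    · have hq' : (1 : ℝ) ≤ q := by exact_mod_cast hq
      refine mul_le_mul_of_nonneg_left
        (one_add_sqrt_pow_sub_one_le (by positivity) k ?_) (by positivity)
      exact (le_mul_of_one_le_left (by positivity) hq').trans h₁.le
  have b₂ := one_add_sqrt_pow_sub_one_le (z := z₂) (by positivity) (q + 1) h₂.le
  refine (A.successProb_le rel).trans (pow_le_pow_left₀ (add_nonneg ?_ ?_) ?_ 2)
  · exact mul_nonneg (Nat.cast_nonneg q)
      (sub_nonneg.2 (one_le_pow₀ (le_add_of_nonneg_right (Real.sqrt_nonneg _))))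
  · exact sub_nonneg.2 (one_le_pow₀ (le_add_of_nonneg_right (Real.sqrt_nonneg _)))
  · linarith

/-- The constants come from `e² ≤ 9` and `q + 2 ≤ 3 q`. -/
theorem chainBound_terms_le {q k : ℕ} (hq : 1 ≤ q) (hk : 0 < k) (T M : ℕ) :
    ((q : ℝ) * k * Real.exp 1 * √(10 * q * k * T / M)) ^ 2
        ≤ 90 * ((q : ℝ) ^ 3 * (k : ℝ) ^ 3 * T / M) ∧
      (Real.exp 1 * ((q : ℝ) + 2) * √(10 * T * ((q : ℝ) + 2) / M)) ^ 2
        ≤ 2430 * ((q : ℝ) ^ 3 * (k : ℝ) ^ 3 * T / M) := by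
  have he : Real.exp 1 ^ 2 ≤ 9 := by
    have h := Real.exp_one_lt_d9
    nlinarith [Real.exp_pos 1]
  have hq' : (1 : ℝ) ≤ q := by exact_mod_cast hq
  have hk' : (1 : ℝ) ≤ k := by exact_mod_cast hk
  constructor
  · rw [mul_pow, Real.sq_sqrt (by positivity)]
    calc _ = Real.exp 1 ^ 2 * (10 * ((q : ℝ) ^ 3 * (k : ℝ) ^ 3 * T / M)) := by ring
      _ ≤ 9 * (10 * ((q : ℝ) ^ 3 * (k : ℝ) ^ 3 * T / M)) := by gcongr
      _ = _ := by ring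
  · rw [mul_pow, Real.sq_sqrt (by positivity)]
    calc _ = Real.exp 1 ^ 2 * (10 * (((q : ℝ) + 2) ^ 3 * 1 * T / M)) := by ring
      _ ≤ 9 * (10 * ((3 * (q : ℝ)) ^ 3 * (k : ℝ) ^ 3 * T / M)) := by
          gcongr
          · linarith
          · exact one_le_pow₀ hk'
      _ = _ := by ring

theorem chainBound_le {q k T : ℕ} (hq : 1 ≤ q) (hk : 0 < k) (hT : 1 ≤ T) (M : ℕ) :
    chainBound q k T M ≤ 10200 * ((q : ℝ) ^ 3 * (k : ℝ) ^ 3 * T / M) := by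
  obtain ⟨h₁, h₂⟩ := chainBound_terms_le hq hk T M
  have hq' : (1 : ℝ) ≤ q := by exact_mod_cast hq
  have hk' : (1 : ℝ) ≤ k := by exact_mod_cast hk
  have hT' : (1 : ℝ) ≤ T := by exact_mod_cast hT
  have h₃ : √(((q : ℝ) + 2) / M) ^ 2 ≤ 3 * ((q : ℝ) ^ 3 * (k : ℝ) ^ 3 * T / M) := by
    rw [Real.sq_sqrt (by positivity)]
    have h : (q : ℝ) + 2 ≤ 3 * ((q : ℝ) ^ 3 * 1 * 1) := by
      linarith [le_self_pow₀ hq' three_ne_zero]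
    calc _ ≤ 3 * ((q : ℝ) ^ 3 * 1 * 1) / M := by gcongr
      _ ≤ 3 * ((q : ℝ) ^ 3 * (k : ℝ) ^ 3 * T) / M := by
          gcongr
          exact one_le_pow₀ hk'
      _ = _ := by ring
  rw [chainBound]
  have h₀ : 0 ≤ (q : ℝ) ^ 3 * (k : ℝ) ^ 3 * T / M := by positivity
  -- `(a + b + c)² ≤ 2 (a + b)² + 2 c² ≤ 4 a² + 4 b² + 2 c²`
  refine (add_sq_le.trans (mul_le_mul_of_nonneg_left
    (add_le_add_left add_sq_le _) zero_le_two)).trans ?_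
  linarith

end

theorem mainTheorem6 :
    ∃ C : ℝ, 0 < C ∧
      ∀ (X Y : Type*) [Fintype X] [DecidableEq X] [Nonempty X] [Fintype Y] [AddCommGroup Y]
        (rel : Y → X → Prop) (k q : ℕ), 0 < k →
        (∀ A : ParallelQueryAlgorithm X Y k q (q + 2),
          A.successProb (IsChainFor rel)
              ≤ chainBound q k (maxRelCard rel) (Fintype.card Y) ∧
          (1 ≤ q → A.successProb (IsChainFor rel)
              ≤ C * ((q : ℝ) ^ 3 * (k : ℝ) ^ 3 * (maxRelCard rel : ℝ) / (Fintype.card Y : ℝ)))) ∧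
        (1 ≤ q → 1 ≤ maxRelCard rel →
          chainBound q k (maxRelCard rel) (Fintype.card Y)
            ≤ C * ((q : ℝ) ^ 3 * (k : ℝ) ^ 3 * (maxRelCard rel : ℝ) / (Fintype.card Y : ℝ))) := by
  refine ⟨10200, by norm_num, fun X Y _ _ _ _ _ rel k q hk => ⟨fun A => ?_, fun hq hT =>
    chainBound_le hq hk hT _⟩⟩
  classical
  have hA := A.successProb_le_add_sq rel
  refine ⟨hA.trans ?_, fun hq => hA.trans ?_⟩
  · rw [chainBound]
    exact pow_le_pow_left₀ (by positivity) (le_add_of_nonneg_right (Real.sqrt_nonneg _)) 2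
  -- The bound without the summand `√((q + 2) / M)` is used here, so that `T = 0` is covered.
  · obtain ⟨h₁, h₂⟩ := chainBound_terms_le hq hk (maxRelCard rel) (Fintype.card Y)
    refine (add_sq_le (a := _) (b := _)).trans ?_
    have h₀ : 0 ≤ (q : ℝ) ^ 3 * (k : ℝ) ^ 3 * (maxRelCard rel : ℝ) / (Fintype.card Y : ℝ) := by
      positivity
    linarith
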